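/- Let $\Omega=\{0,1\}^{\infty}$ with the product topology. For $\omega\in\Omega$ and $t\ge 0$ let $\omega^t\subseteq\Omega$ be the cylinder of all paths that agree with $\omega$ in the first $t$ periods, and let $\Sigma$ be any $\sigma$-algebra on $\Omega$ (its members are the events) that contains all cylinders. Let $\mathbb P$ be the set of finitely additive probabilities on $(\Omega,\Sigma)$. An opinion is a $P\in\mathbb P$ that is strongly nonatomic: for every event $E$ and every $\alpha\in[0,1]$ there is an event $F\subseteq E$ with $P(F)=\alpha P(E)$. Let $\Delta$ be the set of opinions. For $P,Q\in\mathbb P$ write $Q\ll P$ if, for every sequence of events $(E_n)$, $P(E_n)\to 0$ implies $Q(E_n)\to 0$. Say that $P$ merges with $Q$ if for every $\varepsilon>0$ \[\lim_{t\to\infty}Q\Bigl(\Bigl\{\omega:\sup_{E\in\Sigma}\bigl|P(E\mid\omega^t)-Q(E\mid\omega^t)\bigr|>\varepsilon\Bigr\}\Bigr)=0 ,\] where $P(E\mid C)=P(E\cap C)/P(C)$, read as $0$ if $P(C)=0$. Let $\Delta_{\mathrm{BD}}$ be the set of opinions $P$ that merge with every $Q\in\mathbb P$ such that $Q\ll P$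 (the opinions with the Blackwell--Dubins property). A test is a function $T$ from $\Delta$ to the open subsets of $\Omega$; opinion $P$ is rejected on $T(P)$. For $\varepsilon\in[0,1)$, $T$ $\Delta_{\mathrm{BD}}$-controls for type I error with probability $1-\varepsilon$ if $P(T(P))\le\varepsilon$ for every $P\in\Delta_{\mathrm{BD}}$. A strategy is a probability measure on $\Delta$ with finite support. A strictly proper ideal is a collection $\mathcal I$ of subsets of $\Omega$ that is closed under taking subsets and under unions of two members and contains no cylinder; its members are called small. Let $\mathcal I$ be a strictly proper ideal, and let $T$ be a test that $\Delta_{\mathrm{BD}}$-controls for type I error with probability $1-\varepsilon$ for some $\varepsilon\in[0,1)$. Then there exists a strategy $\zeta$ such that the set \[\bigl\{\omega\in\Omega:\ \zeta(\{P\in\Delta:\ \omega\notin T(P)\})=1\bigr\}\] is not small, that is, does not belong to $\mathcal I$. -/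

import Mathlib

open Set Filter Topology
open scoped MeasureTheory

namespace OpinionTest

/-- A path is an infinite sequence of binary outcomes. The space of paths carries the product
topology (the discrete topology on each factor). The cylinder `ω^t` of all paths that agree
with `ω` in the first `t` periods is `PiNat.cylinder ω t`. -/
abbrev Path : Type := ℕ → Bool

/-- A finitely additive probability on `(Path, 𝓢)`, where `𝓢` is the `σ`-algebra of events.
The value at a set that is not an event is fixed to be `0`, so that two probabilities are equal
exactly when they agree on all events. -/
@[ext]
structure FinAddProb (𝓢 : MeasurableSpace Path) where
  toFun : Set Path → ℝ
  zero_of_not_event : ∀ E, ¬ MeasurableSet[𝓢] E → toFun E = 0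
  nonneg : ∀ E, MeasurableSet[𝓢] E → 0 ≤ toFun E
  prob_univ : toFun Set.univ = 1
  prob_union : ∀ E F, MeasurableSet[𝓢] E → MeasurableSet[𝓢] F → Disjoint E F →
    toFun (E ∪ F) = toFun E + toFun F

instance (𝓢 : MeasurableSpace Path) : CoeFun (FinAddProb 𝓢) (fun _ => Set Path → ℝ) :=
  ⟨FinAddProb.toFun⟩

variable {𝓢 : MeasurableSpace Path}

/-- `P` is strongly nonatomic (Savagean). -/
def IsSavagean (P : FinAddProb 𝓢) : Prop :=
  ∀ E, MeasurableSet[𝓢] E → ∀ α : ℝ, 0 ≤ α → α ≤ 1 →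
    ∃ F, F ⊆ E ∧ MeasurableSet[𝓢] F ∧ P F = α * P E

/-- The set `Δ` of opinions: the strongly nonatomic finitely additive probabilities. -/
def Opinion (𝓢 : MeasurableSpace Path) : Type := {P : FinAddProb 𝓢 // IsSavagean P}

/-- The conditional probability `P(E | C) = P(E ∩ C) / P(C)`, with value `0` if `P(C) = 0`. -/
noncomputable def condProb (P : FinAddProb 𝓢) (E C : Set Path) : ℝ := P (E ∩ C) / P C

/-- The distance `sup_{E ∈ 𝓢} |P(E | ω^t) - Q(E | ω^t)|` between the forecasts of `P` and `Q`. -/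
noncomputable def forecastDist (P Q : FinAddProb 𝓢) (ω : Path) (t : ℕ) : ℝ :=
  ⨆ E : {E : Set Path // MeasurableSet[𝓢] E},
    |condProb P E.1 (PiNat.cylinder ω t) - condProb Q E.1 (PiNat.cylinder ω t)|

/-- `P` merges with `Q`: the distance between forecasts goes to `0` in `Q`-probability. For each
`t` the set of paths below is a finite union of cylinders of length `t`, hence an event as soon
as cylinders are events. -/
def Merges (P Q : FinAddProb 𝓢) : Prop :=
  ∀ ε : ℝ, 0 < ε → Tendsto (fun t : ℕ => Q {ω | ε < forecastDist P Q ω t}) atTop (𝓝 0)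

/-- `Q ≪ P`: along every sequence of events, `P (E n) → 0` implies `Q (E n) → 0`. -/
def AbsCont (Q P : FinAddProb 𝓢) : Prop :=
  ∀ E : ℕ → Set Path, (∀ n, MeasurableSet[𝓢] (E n)) →
    Tendsto (fun n => P (E n)) atTop (𝓝 0) → Tendsto (fun n => Q (E n)) atTop (𝓝 0)

/-- The Blackwell--Dubins property: `P` merges with every finitely additive probability that is
absolutely continuous with respect to `P`. -/
def BlackwellDubins (P : FinAddProb 𝓢) : Prop :=
  ∀ Q : FinAddProb 𝓢, AbsCont Q P → Merges P Q

/-- The set `Δ_BD` of opinions with the Blackwell--Dubins property. -/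
def opinionsBD (𝓢 : MeasurableSpace Path) : Set (Opinion 𝓢) := {P | BlackwellDubins P.1}

/-- A test assigns to every opinion the open set of paths on which the opinion is rejected. -/
def Test (𝓢 : MeasurableSpace Path) : Type := Opinion 𝓢 → TopologicalSpace.Opens Path

/-- The test `T` `Λ`-controls for type I error with probability `1 - ε`. -/
def ControlsTypeIError (T : Test 𝓢) (Λ : Set (Opinion 𝓢)) (ε : ℝ) : Prop :=
  ∀ P ∈ Λ, P.1 (T P : Set Path) ≤ ε

/-- A strategy is a probability measure on the set of opinions with finite support. -/
def Strategy (𝓢 : MeasurableSpace Path) : Type :=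
  {ζ : PMF (Opinion 𝓢) // ζ.support.Finite}

/-- The probability `ζ(A)` that a strategy gives to a set `A` of opinions. -/
noncomputable def Strategy.prob (ζ : Strategy 𝓢) (A : Set (Opinion 𝓢)) : ENNReal :=
  ζ.1.toOuterMeasure A

/-- A strictly proper ideal of sets of paths; its members are the small sets. -/
structure IsStrictlyProperIdeal (I : Set (Set Path)) : Prop where
  mem_of_subset : ∀ S R : Set Path, S ∈ I → R ⊆ S → R ∈ I
  union_mem : ∀ R S : Set Path, R ∈ I → S ∈ I → R ∪ S ∈ I
  cylinder_notMem : ∀ (ω : Path) (t : ℕ), PiNat.cylinder ω t ∉ I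

end OpinionTest

/-! It suffices to find one opinion `P` with the Blackwell–Dubins property that vanishes on every
small set. The strategy that always announces `P` passes exactly on the complement of `T P`; were
this closed set small, `P` would reject itself with probability 1 > ε.

To build `P`, take a nonatomic Borel probability μ and let p(X) be the μ-measure of the points at
which X is nowhere locally small. Then p vanishes on the ideal, is submodular, and approximates
every set by finitely determined ones. A Zorn argument (`exists_additive_le`) finds an additive q ≤
p that keeps the approximation property. Domination by μ on closed intervals of the Cantor set makes
q strongly nonatomic (`isSavagean_of_continuous`).

Approximability yields merging (`blackwellDubins_of_finDetDense`): if Q ≪ P, the densities of P with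
respect to P + Q on cylinders form an L² bounded martingale. Its increments control finitely
determined events, hence by density all events uniformly, and a uniform bound forces the conditional
probabilities together. -/

namespace OpinionTest

/-! ### Approximable capacities and their additive minorants -/

/-- A monotone, normalized, submodular set function which is additive along the sets in `𝒞` and
for which every set is almost covered by a member of `𝒞` of nearly the same size. -/
structure IsApproxCapacity {α : Type*} (𝒞 : Set (Set α)) (p : Set α → ℝ) : Prop where
  mono : ∀ X Y, X ⊆ Y → p X ≤ p Y
  empty : p ∅ = 0
  univ : p univ = 1
  submod : ∀ X Y, p (X ∪ Y) + p (X ∩ Y) ≤ p X + p Y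
  compl_le : ∀ C ∈ 𝒞, p C + p Cᶜ ≤ 1
  approx : ∀ X, ∀ δ > 0, ∃ C ∈ 𝒞, p (X \ C) ≤ δ ∧ p C ≤ p X + δ

namespace IsApproxCapacity

variable {α : Type*} {𝒞 : Set (Set α)} {p : Set α → ℝ}

theorem nonneg (hp : IsApproxCapacity 𝒞 p) (X : Set α) : 0 ≤ p X :=
  hp.empty ▸ hp.mono _ _ (empty_subset X)

theorem union_le (hp : IsApproxCapacity 𝒞 p) (X Y : Set α) : p (X ∪ Y) ≤ p X + p Y := by
  linarith [hp.submod X Y, hp.nonneg (X ∩ Y)]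

/-- Submodularity for the pairs (Y, C) and (Y ∪ C, Cᶜ), added up. Together with `union_le`, members
of `𝒞` split every set additively. -/
theorem inter_add_diff_le (hp : IsApproxCapacity 𝒞 p) {C : Set α} (hC : C ∈ 𝒞) (Y : Set α) :
    p (Y ∩ C) + p (Y \ C) ≤ p Y := by
  have h1 := hp.submod Y C
  have h2 := hp.submod (Y ∪ C) Cᶜ
  have h3 : (Y ∪ C) ∪ Cᶜ = Set.univ := by ext; simp; tauto
  have h4 : (Y ∪ C) ∩ Cᶜ = Y \ C := by ext; simp; tauto
  rw [h3, h4, hp.univ] at h2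
  linarith [hp.compl_le C hC]

/-- The set function obtained from `p` by contracting along `E`. -/
def contract (p : Set α → ℝ) (E X : Set α) : ℝ := p (X ∩ E) + p (X ∪ E) - p E

theorem contract_le (hp : IsApproxCapacity 𝒞 p) (E X : Set α) : contract p E X ≤ p X := by
  unfold contract
  linarith [hp.submod X E]

theorem isApproxCapacity_contract (h𝒞u : ∀ C ∈ 𝒞, ∀ D ∈ 𝒞, C ∪ D ∈ 𝒞)
    (h𝒞d : ∀ C ∈ 𝒞, ∀ D ∈ 𝒞, C \ D ∈ 𝒞) (hp : IsApproxCapacity 𝒞 p) (E : Set α) :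
    IsApproxCapacity 𝒞 (contract p E) where
  mono X Y h := by
    have h1 := hp.mono (X ∩ E) (Y ∩ E) (by gcongr)
    have h2 := hp.mono (X ∪ E) (Y ∪ E) (by gcongr)
    unfold contract; linarith
  empty := by simp [contract, hp.empty]
  univ := by simp [contract, hp.univ]
  submod X Y := by
    have h1 := hp.submod (X ∩ E) (Y ∩ E)
    have h2 := hp.submod (X ∪ E) (Y ∪ E)
    rw [← union_inter_distrib_right, ← inter_inter_distrib_right] at h1
    rw [← inter_union_distrib_right, ← union_union_distrib_right] at h2
    unfold contract; linarith
  compl_le C hC := by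
    linarith [hp.compl_le C hC, hp.contract_le E C, hp.contract_le E Cᶜ]
  approx X δ hδ := by
    obtain ⟨C₁, h₁, h₁a, h₁b⟩ := hp.approx (X ∩ E) (δ / 4) (by positivity)
    obtain ⟨C₂, h₂, h₂a, h₂b⟩ := hp.approx (X ∪ E) (δ / 4) (by positivity)
    obtain ⟨C₃, h₃, h₃a, h₃b⟩ := hp.approx E (δ / 4) (by positivity)
    -- Modulo errors of size δ/4, X is X ∩ E together with (X ∪ E) \ E; each piece is replaced by
    -- its approximant.
    refine ⟨C₁ ∪ C₂ \ C₃, h𝒞u _ h₁ _ (h𝒞d _ h₂ _ h₃), ?_, ?_⟩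
    · have e1 : p ((X \ (C₁ ∪ C₂ \ C₃)) ∩ E) ≤ p ((X ∩ E) \ C₁) :=
        hp.mono _ _ (by intro x; simp; tauto)
      have e2 : p ((X \ (C₁ ∪ C₂ \ C₃)) ∪ E) ≤ p ((((X ∪ E) \ C₂) ∪ (E \ C₃)) ∪ C₃) :=
        hp.mono _ _ (by intro x; simp; tauto)
      have e3 := hp.union_le (((X ∪ E) \ C₂) ∪ (E \ C₃)) C₃
      have e4 := hp.union_le ((X ∪ E) \ C₂) (E \ C₃)
      unfold contract; linarith
    · refine (hp.contract_le E _).trans ?_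
      have e1 := hp.union_le C₁ (C₂ \ C₃)
      have e2 := hp.inter_add_diff_le h₃ C₂
      have e3 : p E ≤ p ((((X ∪ E) \ C₂) ∪ (E \ C₃)) ∪ (C₂ ∩ C₃)) :=
        hp.mono _ _ (by intro x; simp; tauto)
      have e4 := hp.union_le (((X ∪ E) \ C₂) ∪ (E \ C₃)) (C₂ ∩ C₃)
      have e5 := hp.union_le ((X ∪ E) \ C₂) (E \ C₃)
      unfold contract; linarith

/-- In a chain, one member is nearly minimal at two given sets at once, which gives submodularity.
For approximation, a set that works for a member nearly minimal at X works for the infimum, which is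
smaller. -/
theorem isApproxCapacity_iInf {c : Set (Set α → ℝ)} (hc : ∀ q ∈ c, IsApproxCapacity 𝒞 q)
    (hchain : IsChain (· ≤ ·) c) (hne : c.Nonempty) :
    IsApproxCapacity 𝒞 (fun X => ⨅ q : c, q.1 X) ∧
      ∀ q ∈ c, (fun X => ⨅ q : c, q.1 X) ≤ q := by
  have : Nonempty c := hne.to_subtype
  set r : Set α → ℝ := fun X => ⨅ q : c, q.1 X with hr
  have hle : ∀ q ∈ c, ∀ X, r X ≤ q X := fun q hq X =>
    ciInf_le (f := fun q : c => q.1 X) ⟨0, by rintro _ ⟨q, rfl⟩; exact (hc q.1 q.2).nonneg X⟩ ⟨q, hq⟩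
  have hge : ∀ X a, (∀ q ∈ c, a ≤ q X) → a ≤ r X := fun X a h => le_ciInf fun q => h q.1 q.2
  have hlt : ∀ X, ∀ δ > 0, ∃ q ∈ c, q X < r X + δ := fun X δ hδ => by
    obtain ⟨q, hq⟩ := exists_lt_of_ciInf_lt (f := fun q : c => q.1 X) (a := r X + δ)
      (by change r X < _; linarith)
    exact ⟨q.1, q.2, hq⟩
  have htwo : ∀ X Y, ∀ δ > 0, ∃ q ∈ c, q X < r X + δ ∧ q Y < r Y + δ := fun X Y δ hδ => by
    obtain ⟨q₁, h₁, h₁'⟩ := hlt X δ hδ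
    obtain ⟨q₂, h₂, h₂'⟩ := hlt Y δ hδ
    rcases hchain.total h₁ h₂ with h | h
    · exact ⟨q₁, h₁, h₁', (h Y).trans_lt h₂'⟩
    · exact ⟨q₂, h₂, (h X).trans_lt h₁', h₂'⟩
  obtain ⟨q₀, h₀⟩ := hne
  refine ⟨⟨?_, ?_, ?_, ?_, ?_, ?_⟩, fun q hq X => hle q hq X⟩
  · exact fun X Y h => hge _ _ fun q hq => (hle q hq X).trans ((hc q hq).mono X Y h)
  · exact le_antisymm ((hle q₀ h₀ _).trans (hc q₀ h₀).empty.le)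
      (hge _ _ fun q hq => (hc q hq).empty.ge)
  · exact le_antisymm ((hle q₀ h₀ _).trans (hc q₀ h₀).univ.le)
      (hge _ _ fun q hq => (hc q hq).univ.ge)
  · intro X Y
    refine le_of_forall_pos_le_add fun δ hδ => ?_
    obtain ⟨q, hq, h1, h2⟩ := htwo X Y (δ / 2) (by positivity)
    linarith [hle q hq (X ∪ Y), hle q hq (X ∩ Y), (hc q hq).submod X Y]
  · exact fun C hC => (add_le_add (hle q₀ h₀ _) (hle q₀ h₀ _)).trans ((hc q₀ h₀).compl_le C hC)
  · intro X δ hδ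
    obtain ⟨q, hq, h1⟩ := hlt X (δ / 2) (by positivity)
    obtain ⟨C, hC, h2, h3⟩ := (hc q hq).approx X (δ / 2) (by positivity)
    exact ⟨C, hC, by linarith [hle q hq (X \ C)], by linarith [hle q hq C]⟩

/-- Below every approximable capacity there is an additive one. -/
theorem exists_additive_le (h𝒞u : ∀ C ∈ 𝒞, ∀ D ∈ 𝒞, C ∪ D ∈ 𝒞)
    (h𝒞d : ∀ C ∈ 𝒞, ∀ D ∈ 𝒞, C \ D ∈ 𝒞) (hp : IsApproxCapacity 𝒞 p) :
    ∃ q, IsApproxCapacity 𝒞 q ∧ q ≤ p ∧ ∀ X Y, Disjoint X Y → q (X ∪ Y) = q X + q Y := by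
  -- Zorn in the dual order gives a minimal capacity below `p`.
  obtain ⟨m, hmp, hm, hmin⟩ := zorn_le_nonempty₀ (α := (Set α → ℝ)ᵒᵈ)
    {q | IsApproxCapacity 𝒞 (OrderDual.ofDual q)}
    (fun c hc hchain y hy => by
      obtain ⟨h1, h2⟩ := isApproxCapacity_iInf (c := OrderDual.toDual ⁻¹' c) (fun q hq => hc hq)
        hchain.symm ⟨OrderDual.ofDual y, hy⟩
      exact ⟨OrderDual.toDual _, h1, fun z hz => h2 _ hz⟩) (OrderDual.toDual p) hp
  refine ⟨OrderDual.ofDual m, hm, hmp, fun X Y hXY => ?_⟩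
  -- Contracting along Y cannot lower a minimal capacity, so m X + m Y ≤ m (X ∩ Y) + m (X ∪ Y). For
  -- disjoint sets this is superadditivity.
  have h1 := hmin (y := OrderDual.toDual (contract (OrderDual.ofDual m) Y))
    (isApproxCapacity_contract h𝒞u h𝒞d hm Y) (fun X => contract_le hm Y X) X
  have h2 : OrderDual.ofDual m X ≤ contract (OrderDual.ofDual m) Y X := h1
  unfold contract at h2
  rw [hXY.inter_eq, IsApproxCapacity.empty hm] at h2
  linarith [IsApproxCapacity.union_le hm X Y]

end IsApproxCapacity

open PiNat (cylinder self_mem_cylinder mem_cylinder_comm cylinder_anti)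

/-! ### Finitely determined sets and measurability -/

/-- The sets of paths that are determined by finitely many periods. -/
def finDet : Set (Set Path) := {C | ∃ n, ∀ ω, ∀ ω' ∈ cylinder ω n, ω ∈ C → ω' ∈ C}

theorem compl_mem_finDet {C : Set Path} (hC : C ∈ finDet) : Cᶜ ∈ finDet := by
  obtain ⟨n, hn⟩ := hC
  exact ⟨n, fun ω ω' h hω hω' => hω (hn ω' ω ((mem_cylinder_comm _ _ _).1 h) hω')⟩

theorem union_mem_finDet {C D : Set Path} (hC : C ∈ finDet) (hD : D ∈ finDet) :
    C ∪ D ∈ finDet := by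
  obtain ⟨n, hn⟩ := hC
  obtain ⟨m, hm⟩ := hD
  refine ⟨max n m, fun ω ω' h => ?_⟩
  rintro (hω | hω)
  · exact Or.inl (hn ω ω' (cylinder_anti ω (le_max_left n m) h) hω)
  · exact Or.inr (hm ω ω' (cylinder_anti ω (le_max_right n m) h) hω)

theorem diff_mem_finDet {C D : Set Path} (hC : C ∈ finDet) (hD : D ∈ finDet) :
    C \ D ∈ finDet := by
  have h := compl_mem_finDet (union_mem_finDet (compl_mem_finDet hC) hD)
  rwa [compl_union, compl_compl] at h

/-- The first `n` outcomes of a path. -/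
def proj (n : ℕ) (ω : Path) : Fin n → Bool := fun i => ω i

theorem proj_eq_iff {n : ℕ} {ω ω' : Path} : proj n ω' = proj n ω ↔ ω' ∈ cylinder ω n := by
  simp [proj, funext_iff, Fin.forall_iff, PiNat.mem_cylinder_iff]

theorem proj_preimage_singleton (n : ℕ) (ω : Path) :
    proj n ⁻¹' {proj n ω} = cylinder ω n := by
  ext ω'; exact proj_eq_iff

theorem proj_surjective (n : ℕ) : Function.Surjective (proj n) := fun s =>
  ⟨fun i => if h : i < n then s ⟨i, h⟩ else false, by ext i; simp [proj]⟩

theorem measurableSet_proj_preimage {𝓢 : MeasurableSpace Path}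
    (h𝓢 : ∀ (ω : Path) (t : ℕ), MeasurableSet[𝓢] (cylinder ω t)) {n : ℕ}
    (A : Set (Fin n → Bool)) : MeasurableSet[𝓢] (proj n ⁻¹' A) := by
  rw [← biUnion_preimage_singleton]
  refine MeasurableSet.biUnion (Set.to_countable _) fun s _ => ?_
  obtain ⟨ω, rfl⟩ := proj_surjective n s
  rw [proj_preimage_singleton]
  exact h𝓢 ω n

theorem eq_proj_preimage {C : Set Path} {n : ℕ}
    (hn : ∀ ω, ∀ ω' ∈ cylinder ω n, ω ∈ C → ω' ∈ C) : C = proj n ⁻¹' (proj n '' C) := by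
  refine Subset.antisymm (subset_preimage_image _ _) ?_
  rintro ω' ⟨ω, hω, h⟩
  exact hn ω ω' (proj_eq_iff.1 h.symm) hω

theorem measurableSet_of_mem_finDet {𝓢 : MeasurableSpace Path}
    (h𝓢 : ∀ (ω : Path) (t : ℕ), MeasurableSet[𝓢] (cylinder ω t)) {C : Set Path}
    (hC : C ∈ finDet) : MeasurableSet[𝓢] C := by
  obtain ⟨n, hn⟩ := hC
  rw [eq_proj_preimage hn]
  exact measurableSet_proj_preimage h𝓢 _

/-- A closed set is the intersection over n of the unions of the length-n cylinders that meet it. -/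
theorem measurableSet_of_isClosed {𝓢 : MeasurableSpace Path}
    (h𝓢 : ∀ (ω : Path) (t : ℕ), MeasurableSet[𝓢] (cylinder ω t)) {F : Set Path}
    (hF : IsClosed F) : MeasurableSet[𝓢] F := by
  have : F = ⋂ n, {ω | (F ∩ cylinder ω n).Nonempty} := by
    refine Subset.antisymm (subset_iInter fun n ω hω => ⟨ω, hω, self_mem_cylinder ω n⟩) ?_
    intro ω hω
    by_contra h
    obtain ⟨n, hn⟩ := PiNat.exists_disjoint_cylinder hF h
    obtain ⟨ω', h1, h2⟩ := mem_iInter.1 hω n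
    exact hn.le_bot ⟨h1, h2⟩
  rw [this]
  refine MeasurableSet.iInter fun n => measurableSet_of_mem_finDet h𝓢 ⟨n, fun ω ω' h hω => ?_⟩
  rw [mem_ofPred_eq, PiNat.mem_cylinder_iff_eq.1 h]
  exact hω

theorem measurableSet_cylinder (ω : Path) (t : ℕ) : MeasurableSet (cylinder ω t) :=
  (PiNat.isOpen_cylinder (E := fun _ => Bool) ω t).measurableSet

/-! ### The capacity attached to a strictly proper ideal -/

/-- The points at which the set `X` is nowhere locally small. -/
def bigPoints (I : Set (Set Path)) (X : Set Path) : Set Path := {ω | ∀ n, X ∩ cylinder ω n ∉ I}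

theorem finDet_setOf_inter_cylinder_notMem (I : Set (Set Path)) (X : Set Path) (n : ℕ) :
    {ω | X ∩ cylinder ω n ∉ I} ∈ finDet := by
  refine ⟨n, fun ω ω' h hω => ?_⟩
  rw [mem_ofPred_eq, PiNat.mem_cylinder_iff_eq.1 h]
  exact hω

theorem bigPoints_eq_iInter (I : Set (Set Path)) (X : Set Path) :
    bigPoints I X = ⋂ n, {ω | X ∩ cylinder ω n ∉ I} := by
  ext; simp [bigPoints]

theorem measurableSet_bigPoints (I : Set (Set Path)) (X : Set Path) :
    MeasurableSet (bigPoints I X) := by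
  rw [bigPoints_eq_iInter]
  exact MeasurableSet.iInter fun n => measurableSet_of_mem_finDet measurableSet_cylinder
    (finDet_setOf_inter_cylinder_notMem I X n)

section Ideal

variable {I : Set (Set Path)}

theorem bigPoints_mono (hI : IsStrictlyProperIdeal I) {X Y : Set Path} (h : X ⊆ Y) :
    bigPoints I X ⊆ bigPoints I Y := fun _ hω n hn =>
  hω n (hI.mem_of_subset _ _ hn (inter_subset_inter_left _ h))

theorem bigPoints_union (hI : IsStrictlyProperIdeal I) (X Y : Set Path) :
    bigPoints I (X ∪ Y) = bigPoints I X ∪ bigPoints I Y := by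
  refine Subset.antisymm (fun ω hω => ?_) (union_subset (bigPoints_mono hI subset_union_left)
    (bigPoints_mono hI subset_union_right))
  by_contra h
  simp only [bigPoints, mem_union, mem_ofPred_eq, not_or, not_forall, not_not] at h
  obtain ⟨⟨n, hn⟩, m, hm⟩ := h
  refine hω (max n m) ?_
  rw [union_inter_distrib_right]
  exact hI.union_mem _ _
    (hI.mem_of_subset _ _ hn (inter_subset_inter_right _ (cylinder_anti ω (le_max_left n m))))
    (hI.mem_of_subset _ _ hm (inter_subset_inter_right _ (cylinder_anti ω (le_max_right n m))))

theorem bigPoints_eq_empty (hI : IsStrictlyProperIdeal I) {S : Set Path} (hS : S ∈ I) :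
    bigPoints I S = ∅ :=
  eq_empty_of_forall_notMem fun _ hω => hω 0 (hI.mem_of_subset _ _ hS inter_subset_left)

theorem bigPoints_univ (hI : IsStrictlyProperIdeal I) : bigPoints I univ = univ :=
  eq_univ_of_forall fun ω n => by rw [univ_inter]; exact hI.cylinder_notMem ω n

theorem bigPoints_subset_of_isClosed (h0 : ∅ ∈ I) {F : Set Path} (hF : IsClosed F) :
    bigPoints I F ⊆ F := fun ω hω => by
  by_contra h
  obtain ⟨n, hn⟩ := PiNat.exists_disjoint_cylinder hF h
  exact hω n (by rwa [hn.inter_eq])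

theorem bigPoints_subset_of_mem_finDet (h0 : ∅ ∈ I) {C : Set Path} (hC : C ∈ finDet) :
    bigPoints I C ⊆ C := fun ω hω => by
  obtain ⟨n, hn⟩ := hC
  have : (C ∩ cylinder ω n).Nonempty := by
    rw [nonempty_iff_ne_empty]
    intro h
    exact hω n (by rwa [h])
  obtain ⟨ω', h1, h2⟩ := this
  exact hn ω' ω ((mem_cylinder_comm _ _ _).1 h2) h1

theorem isApproxCapacity_bigPoints (hI : IsStrictlyProperIdeal I) (h0 : ∅ ∈ I)
    (μ : MeasureTheory.Measure Path) [MeasureTheory.IsProbabilityMeasure μ] :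
    IsApproxCapacity finDet (fun X => μ.real (bigPoints I X)) where
  mono X Y h := MeasureTheory.measureReal_mono (bigPoints_mono hI h)
  empty := by rw [bigPoints_eq_empty hI h0]; simp
  univ := by rw [bigPoints_univ hI]; simp
  submod X Y := by
    rw [bigPoints_union hI, ← MeasureTheory.measureReal_union_add_inter
      (measurableSet_bigPoints I Y)]
    gcongr
    · exact MeasureTheory.measure_ne_top _ _
    · exact subset_inter (bigPoints_mono hI inter_subset_left)
        (bigPoints_mono hI inter_subset_right)
  compl_le C hC := by
    rw [← MeasureTheory.probReal_add_probReal_compl (μ := μ)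
      (measurableSet_of_mem_finDet measurableSet_cylinder hC)]
    exact add_le_add (MeasureTheory.measureReal_mono (bigPoints_subset_of_mem_finDet h0 hC))
      (MeasureTheory.measureReal_mono
        (bigPoints_subset_of_mem_finDet h0 (compl_mem_finDet hC)))
  approx X δ hδ := by
    -- `C n` is determined by n periods and decreases to `bigPoints I X`. The rest X \ `C n` has no
    -- big points: a length-n cylinder lies inside `C n` or meets X in a small set.
    set C : ℕ → Set Path := fun n => {ω | X ∩ cylinder ω n ∉ I} with hCdef
    have hC : ∀ n, C n ∈ finDet := finDet_setOf_inter_cylinder_notMem I X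
    have hanti : Antitone C := fun n m h ω hω hn =>
      hω (hI.mem_of_subset _ _ hn (inter_subset_inter_right _ (cylinder_anti ω h)))
    have hlim : Tendsto (fun n => μ.real (C n)) atTop (𝓝 (μ.real (bigPoints I X))) := by
      rw [bigPoints_eq_iInter]
      refine (ENNReal.tendsto_toReal (MeasureTheory.measure_ne_top _ _)).comp
        (MeasureTheory.tendsto_measure_iInter_atTop (fun n =>
          (measurableSet_of_mem_finDet measurableSet_cylinder (hC n)).nullMeasurableSet) hanti
          ⟨0, MeasureTheory.measure_ne_top _ _⟩)
    obtain ⟨n, hn⟩ := (hlim.eventually_lt_const (lt_add_of_pos_right _ hδ)).exists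
    refine ⟨C n, hC n, ?_, ?_⟩
    · have : bigPoints I (X \ C n) = ∅ := by
        refine eq_empty_of_forall_notMem fun ω hω => hω n ?_
        by_cases h : ω ∈ C n
        · have : (X \ C n) ∩ cylinder ω n = ∅ := by
            refine eq_empty_of_forall_notMem fun ω' hω' => hω'.1.2 ?_
            rw [hCdef, mem_ofPred_eq, PiNat.mem_cylinder_iff_eq.1 hω'.2]
            exact h
          rwa [this]
        · exact hI.mem_of_subset _ _ (not_not.1 h) (inter_subset_inter_left _ sdiff_subset)
      rw [this]; simpa using hδ.le
    · exact (MeasureTheory.measureReal_mono (bigPoints_subset_of_mem_finDet h0 (hC n))).trans hn.le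

end Ideal

/-! ### A nonatomic measure, read on the Cantor set -/

theorem exists_noAtoms_measure_path :
    ∃ μ : MeasureTheory.Measure Path, MeasureTheory.IsProbabilityMeasure μ ∧
      MeasureTheory.NullSingletonClass μ := by
  have hunc : ¬ Countable Path := by
    rw [not_countable_iff, ← Cardinal.aleph0_lt_mk_iff]
    simpa using Cardinal.cantor Cardinal.aleph0
  have hunc' : ¬ Countable ℝ := by rw [not_countable_iff]; infer_instance
  let e : ℝ ≃ᵐ Path := PolishSpace.measurableEquivOfNotCountable hunc' hunc
  let ν : MeasureTheory.Measure ℝ := MeasureTheory.volume.restrict (Icc 0 1)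
  have : MeasureTheory.IsProbabilityMeasure ν := ⟨by simp [ν]⟩
  refine ⟨ν.map e, MeasureTheory.Measure.isProbabilityMeasure_map e.measurable.aemeasurable,
    ⟨fun x => ?_⟩⟩
  rw [MeasureTheory.Measure.map_apply e.measurable (measurableSet_singleton x)]
  exact (Set.subsingleton_singleton.preimage e.injective).measure_zero ν

theorem continuous_cdf_of_noAtoms (ν : MeasureTheory.Measure ℝ)
    [MeasureTheory.IsProbabilityMeasure ν] [MeasureTheory.NullSingletonClass ν] :
    Continuous (ProbabilityTheory.cdf ν) := by
  rw [continuous_iff_continuousAt]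
  intro x
  rw [(ProbabilityTheory.monotone_cdf ν).continuousAt_iff_leftLim_eq_rightLim,
    StieltjesFunction.rightLim_eq]
  have h := StieltjesFunction.measure_singleton (ProbabilityTheory.cdf ν) x
  rw [ProbabilityTheory.measure_cdf, MeasureTheory.measure_singleton, eq_comm,
    ENNReal.ofReal_eq_zero] at h
  exact le_antisymm ((ProbabilityTheory.monotone_cdf ν).leftLim_le le_rfl) (by linarith)

/-- The embedding of the space of paths into the real line as the Cantor set. -/
noncomputable def cantorCoord (ω : Path) : ℝ := cantorSetHomeomorphNatToBool.symm ω

theorem continuous_cantorCoord : Continuous cantorCoord :=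
  continuous_subtype_val.comp cantorSetHomeomorphNatToBool.symm.continuous

theorem cantorCoord_injective : Function.Injective cantorCoord :=
  Subtype.val_injective.comp cantorSetHomeomorphNatToBool.symm.injective

theorem cantorCoord_mem_Icc (ω : Path) : cantorCoord ω ∈ Icc (0 : ℝ) 1 :=
  cantorSet_subset_unitInterval (cantorSetHomeomorphNatToBool.symm ω).2

theorem exists_continuous_measure_cantorCoord_preimage (μ : MeasureTheory.Measure Path)
    [MeasureTheory.IsProbabilityMeasure μ] [MeasureTheory.NullSingletonClass μ] :
    ∃ G : ℝ → ℝ, Continuous G ∧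
      ∀ x y, x ≤ y → μ.real (cantorCoord ⁻¹' Icc x y) = G y - G x := by
  have hfm := continuous_cantorCoord.measurable
  set ν := μ.map cantorCoord with hν
  have : MeasureTheory.IsProbabilityMeasure ν :=
    MeasureTheory.Measure.isProbabilityMeasure_map hfm.aemeasurable
  have : MeasureTheory.NullSingletonClass ν := ⟨fun x => by
    rw [hν, MeasureTheory.Measure.map_apply hfm (measurableSet_singleton x)]
    exact (Set.subsingleton_singleton.preimage cantorCoord_injective).measure_zero μ⟩
  refine ⟨ProbabilityTheory.cdf ν, continuous_cdf_of_noAtoms ν, fun x y hxy => ?_⟩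
  have e5 : μ.real (cantorCoord ⁻¹' Icc x y) = ν.real (Icc x y) := by
    rw [hν, MeasureTheory.map_measureReal_apply hfm measurableSet_Icc]
  rw [e5, ProbabilityTheory.cdf_eq_real, ProbabilityTheory.cdf_eq_real,
    ← MeasureTheory.measureReal_congr (MeasureTheory.Ioc_ae_eq_Icc (μ := ν)),
    ← Iic_sdiff_Iic, MeasureTheory.measureReal_sdiff (Iic_subset_Iic.2 hxy) measurableSet_Iic]

/-- There is an additive capacity that vanishes on a given strictly proper ideal and gives
uniformly small probability to short intervals of the Cantor set. -/
theorem exists_additive_capacity {I : Set (Set Path)} (hI : IsStrictlyProperIdeal I)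
    (h0 : ∅ ∈ I) :
    ∃ q : Set Path → ℝ, IsApproxCapacity finDet q ∧
      (∀ X Y, Disjoint X Y → q (X ∪ Y) = q X + q Y) ∧ (∀ S ∈ I, q S = 0) ∧
      ∃ G : ℝ → ℝ, Continuous G ∧ ∀ x y, x ≤ y → q (cantorCoord ⁻¹' Icc x y) ≤ G y - G x := by
  obtain ⟨μ, hμ, hμ'⟩ := exists_noAtoms_measure_path
  obtain ⟨q, hq, hle, hadd⟩ := (isApproxCapacity_bigPoints hI h0 μ).exists_additive_le
    (fun C hC D hD => union_mem_finDet hC hD) (fun C hC D hD => diff_mem_finDet hC hD)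
  obtain ⟨G, hG, hG'⟩ := exists_continuous_measure_cantorCoord_preimage μ
  refine ⟨q, hq, hadd, fun S hS => le_antisymm ((hle S).trans ?_) (hq.nonneg S), G, hG,
    fun x y hxy => (hle _).trans ?_⟩
  · simp [bigPoints_eq_empty hI hS]
  · rw [← hG' x y hxy]
    exact MeasureTheory.measureReal_mono
      (bigPoints_subset_of_isClosed h0 (isClosed_Icc.preimage continuous_cantorCoord))

/-! ### Finitely additive probabilities, density and strong nonatomicity -/

variable {𝓢 : MeasurableSpace Path}

/-- The finitely additive probability on events given by an additive capacity on all sets. -/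
noncomputable def IsApproxCapacity.toFinAddProb {𝒞 : Set (Set Path)} {q : Set Path → ℝ}
    (hq : IsApproxCapacity 𝒞 q) (hadd : ∀ X Y, Disjoint X Y → q (X ∪ Y) = q X + q Y)
    (𝓢 : MeasurableSpace Path) : FinAddProb 𝓢 := by
  classical
  exact
  { toFun := fun E => if MeasurableSet[𝓢] E then q E else 0
    zero_of_not_event := fun E hE => if_neg hE
    nonneg := fun E hE => by rw [if_pos hE]; exact hq.nonneg E
    prob_univ := by rw [if_pos MeasurableSet.univ]; exact hq.univ
    prob_union := fun E F hE hF h => by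
      rw [if_pos hE, if_pos hF, if_pos (hE.union hF)]; exact hadd E F h }

theorem IsApproxCapacity.toFinAddProb_apply {𝒞 : Set (Set Path)} {q : Set Path → ℝ}
    (hq : IsApproxCapacity 𝒞 q) (hadd : ∀ X Y, Disjoint X Y → q (X ∪ Y) = q X + q Y)
    {E : Set Path} (hE : MeasurableSet[𝓢] E) : hq.toFinAddProb hadd 𝓢 E = q E :=
  if_pos hE

/-- Events are approximable by sets that are determined by finitely many periods. -/
def FinDetDense (P : FinAddProb 𝓢) : Prop :=
  ∀ E, MeasurableSet[𝓢] E → ∀ δ > 0, ∃ C ∈ finDet, P (E \ C) < δ ∧ P (C \ E) < δ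

/-- Additivity turns the bound on q C into one on q (C \ E), since q (C ∩ E) is already within δ/3
of q E. -/
theorem IsApproxCapacity.finDetDense_toFinAddProb
    (h𝓢 : ∀ (ω : Path) (t : ℕ), MeasurableSet[𝓢] (cylinder ω t)) {q : Set Path → ℝ}
    (hq : IsApproxCapacity finDet q) (hadd : ∀ X Y, Disjoint X Y → q (X ∪ Y) = q X + q Y) :
    FinDetDense (hq.toFinAddProb hadd 𝓢) := by
  intro E hE δ hδ
  obtain ⟨C, hC, h1, h2⟩ := hq.approx E (δ / 3) (by positivity)
  have hCm := measurableSet_of_mem_finDet h𝓢 hC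
  refine ⟨C, hC, ?_, ?_⟩
  · rw [hq.toFinAddProb_apply hadd (hE.diff hCm)]; linarith
  · rw [hq.toFinAddProb_apply hadd (hCm.diff hE)]
    have e1 := hadd (C ∩ E) (C \ E) disjoint_inf_sdiff
    have e2 := hadd (E ∩ C) (E \ C) disjoint_inf_sdiff
    rw [inter_union_sdiff] at e1 e2
    rw [inter_comm] at e2
    linarith

namespace FinAddProb

variable (P : FinAddProb 𝓢)

theorem nonneg' (E : Set Path) : 0 ≤ P E := by
  by_cases h : MeasurableSet[𝓢] E
  · exact P.nonneg E h
  · exact (P.zero_of_not_event E h).ge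

theorem apply_empty : P ∅ = 0 := by
  have h := P.prob_union ∅ ∅ MeasurableSet.empty MeasurableSet.empty (disjoint_bot_left)
  simpa using h

theorem inter_add_diff {E F : Set Path} (hE : MeasurableSet[𝓢] E) (hF : MeasurableSet[𝓢] F) :
    P (E ∩ F) + P (E \ F) = P E := by
  rw [← P.prob_union _ _ (hE.inter hF) (hE.diff hF) disjoint_inf_sdiff, inter_union_sdiff]

theorem mono {E F : Set Path} (hE : MeasurableSet[𝓢] E) (hF : MeasurableSet[𝓢] F) (h : E ⊆ F) :
    P E ≤ P F := by
  rw [← P.inter_add_diff hF hE, inter_eq_right.2 h]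
  linarith [P.nonneg' (F \ E)]

theorem apply_compl {E : Set Path} (hE : MeasurableSet[𝓢] E) : P Eᶜ = 1 - P E := by
  have h := P.inter_add_diff MeasurableSet.univ hE
  rw [univ_inter, ← compl_eq_univ_sdiff, P.prob_univ] at h
  linarith

theorem sum_inter_fiber {κ : Type*} [Fintype κ] (f : Path → κ)
    (hf : ∀ k, MeasurableSet[𝓢] (f ⁻¹' {k})) {E : Set Path} (hE : MeasurableSet[𝓢] E) :
    ∑ k, P (E ∩ f ⁻¹' {k}) = P E := by
  classical
  have key : ∀ A : Finset κ, ∑ k ∈ A, P (E ∩ f ⁻¹' {k}) = P (E ∩ f ⁻¹' A) := by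
    intro A
    induction A using Finset.induction_on with
    | empty => simp [P.apply_empty]
    | insert a A ha ih =>
      have hA : MeasurableSet[𝓢] (f ⁻¹' (A : Set κ)) := by
        rw [← biUnion_preimage_singleton]
        exact MeasurableSet.biUnion A.countable_toSet fun k _ => hf k
      rw [Finset.sum_insert ha, ih, ← P.prob_union _ _ (hE.inter (hf a)) (hE.inter hA),
        Finset.coe_insert, insert_eq, preimage_union, inter_union_distrib_left]
      refine Disjoint.mono inter_subset_right inter_subset_right (Disjoint.preimage f ?_)
      simpa using ha
  simpa using key Finset.univ

end FinAddProb

/-- A finitely additive probability which gives uniformly small probability to short intervals of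
the Cantor set is strongly nonatomic. -/
theorem isSavagean_of_continuous
    (h𝓢 : ∀ (ω : Path) (t : ℕ), MeasurableSet[𝓢] (cylinder ω t)) {P : FinAddProb 𝓢} {G : ℝ → ℝ}
    (hG : Continuous G)
    (hG' : ∀ x y, x ≤ y → P (cantorCoord ⁻¹' Icc x y) ≤ G y - G x) : IsSavagean P := by
  intro E hE α hα₀ hα₁
  have hm : ∀ c, MeasurableSet[𝓢] (cantorCoord ⁻¹' Iic c) := fun c =>
    measurableSet_of_isClosed h𝓢 (isClosed_Iic.preimage continuous_cantorCoord)
  -- Sweep E from left to right: the increments of `h` are dominated by those of `G`, so `h` is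
  -- continuous and the intermediate value theorem applies.
  set h : ℝ → ℝ := fun c => P (E ∩ cantorCoord ⁻¹' Iic c) with hh
  have hmono : Monotone h := fun x y hxy => P.mono (hE.inter (hm x)) (hE.inter (hm y))
    (inter_subset_inter_right _ (preimage_mono (Iic_subset_Iic.2 hxy)))
  have hinc : ∀ x y, x ≤ y → h y - h x ≤ G y - G x := by
    intro x y hxy
    have e1 := P.inter_add_diff (hE.inter (hm y)) (hE.inter (hm x))
    have e2 : (E ∩ cantorCoord ⁻¹' Iic y) ∩ (E ∩ cantorCoord ⁻¹' Iic x) = E ∩ cantorCoord ⁻¹' Iic x :=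
      inter_eq_right.2 (inter_subset_inter_right _ (preimage_mono (Iic_subset_Iic.2 hxy)))
    have hcl : IsClosed (cantorCoord ⁻¹' Icc x y) := isClosed_Icc.preimage continuous_cantorCoord
    have e3 : P ((E ∩ cantorCoord ⁻¹' Iic y) \ (E ∩ cantorCoord ⁻¹' Iic x)) ≤ P (cantorCoord ⁻¹' Icc x y) := by
      refine P.mono ((hE.inter (hm y)).diff (hE.inter (hm x)))
        (measurableSet_of_isClosed h𝓢 hcl) ?_
      rintro ω ⟨⟨h1, h2⟩, h3⟩
      exact ⟨le_of_not_ge fun h4 => h3 ⟨h1, h4⟩, h2⟩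
    have e4 := hG' x y hxy
    rw [e2] at e1
    simp only [hh]
    linarith
  have habs : ∀ x y, |h y - h x| ≤ |G y - G x| := by
    intro x y
    rcases le_total x y with hxy | hxy
    · rw [abs_of_nonneg (sub_nonneg.2 (hmono hxy))]
      exact (hinc x y hxy).trans (le_abs_self _)
    · rw [abs_sub_comm, abs_sub_comm (G y),
        abs_of_nonneg (sub_nonneg.2 (hmono hxy))]
      exact (hinc y x hxy).trans (le_abs_self _)
  have hcont : Continuous h := by
    rw [Metric.continuous_iff]
    intro x δ hδ
    obtain ⟨η, hη, hη'⟩ := Metric.continuous_iff.1 hG x δ hδ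
    exact ⟨η, hη, fun y hy => (habs x y).trans_lt (hη' y hy)⟩
  -- The sweep starts at -1, where no path has been reached; at 0 the leftmost path is already
  -- included.
  have h0 : h (-1) = 0 := by
    have : E ∩ cantorCoord ⁻¹' Iic (-1) = ∅ := eq_empty_of_forall_notMem fun ω hω => by
      have h1 : cantorCoord ω ≤ -1 := hω.2
      linarith [(cantorCoord_mem_Icc ω).1]
    simp only [hh, this, P.apply_empty]
  have h1 : h 1 = P E := by
    have : E ∩ cantorCoord ⁻¹' Iic 1 = E := inter_eq_left.2 fun ω _ => (cantorCoord_mem_Icc ω).2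
    simp only [hh, this]
  have hmem : α * P E ∈ Icc (h (-1)) (h 1) := by
    rw [h0, h1]
    exact ⟨mul_nonneg hα₀ (P.nonneg' E), mul_le_of_le_one_left (P.nonneg' E) hα₁⟩
  obtain ⟨c, -, hc⟩ := intermediate_value_Icc (by norm_num : (-1 : ℝ) ≤ 1) hcont.continuousOn hmem
  exact ⟨E ∩ cantorCoord ⁻¹' Iic c, inter_subset_left, hE.inter (hm c), hc⟩

theorem AbsCont.exists_pos {P Q : FinAddProb 𝓢} (h : AbsCont Q P) {τ : ℝ} (hτ : 0 < τ) :
    ∃ δ > 0, ∀ E, MeasurableSet[𝓢] E → P E < δ → Q E < τ := by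
  by_contra! hcon
  choose E hE hPE hQE using fun n : ℕ => hcon (1 / ((n : ℝ) + 1)) (by positivity)
  have h1 : Tendsto (fun n => P (E n)) atTop (𝓝 0) :=
    squeeze_zero (fun n => P.nonneg' _) (fun n => (hPE n).le)
      tendsto_one_div_add_atTop_nhds_zero_nat
  obtain ⟨n, hn⟩ := ((h E hE h1).eventually_lt_const hτ).exists
  exact absurd hn (not_lt.2 (hQE n))

/-! ### Cells and sums over cells -/

/-- The cylinder of length `n` with initial segment `s`. -/
def cell {n : ℕ} (s : Fin n → Bool) : Set Path := proj n ⁻¹' {s}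

section Cells

variable (h𝓢 : ∀ (ω : Path) (t : ℕ), MeasurableSet[𝓢] (cylinder ω t))
include h𝓢

theorem measurableSet_cell {n : ℕ} (s : Fin n → Bool) : MeasurableSet[𝓢] (cell s) :=
  measurableSet_proj_preimage h𝓢 {s}

theorem FinAddProb.sum_inter_cell (P : FinAddProb 𝓢) (n : ℕ) {E : Set Path}
    (hE : MeasurableSet[𝓢] E) : ∑ s : Fin n → Bool, P (E ∩ cell s) = P E :=
  P.sum_inter_fiber (proj n) (fun s => measurableSet_cell h𝓢 s) hE

theorem FinAddProb.sum_cell (P : FinAddProb 𝓢) (n : ℕ) : ∑ s : Fin n → Bool, P (cell s) = 1 := by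
  have h := P.sum_inter_cell h𝓢 n MeasurableSet.univ
  simpa only [univ_inter, P.prob_univ] using h

open Classical in
theorem FinAddProb.apply_proj_preimage (P : FinAddProb 𝓢) {n : ℕ} (B : Set (Fin n → Bool)) :
    P (proj n ⁻¹' B) = ∑ s, if s ∈ B then P (cell s) else 0 := by
  rw [← P.sum_inter_cell h𝓢 n (measurableSet_proj_preimage h𝓢 B)]
  refine Finset.sum_congr rfl fun s _ => ?_
  split_ifs with hs
  · rw [inter_eq_right.2]
    exact preimage_mono (singleton_subset_iff.2 hs)
  · rw [cell, ← preimage_inter, inter_singleton_eq_empty.2 hs, preimage_empty, P.apply_empty]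

theorem FinAddProb.sum_restrict_mul (P : FinAddProb 𝓢) {t m : ℕ} (htm : t ≤ m)
    (g : (Fin t → Bool) → ℝ) {E : Set Path} (hE : MeasurableSet[𝓢] E) :
    ∑ u : Fin m → Bool, g (u ∘ Fin.castLE htm) * P (E ∩ cell u) =
      ∑ s, g s * P (E ∩ cell s) := by
  classical
  have key : ∀ (s : Fin t → Bool) (u : Fin m → Bool), P ((E ∩ cell s) ∩ cell u) =
      if s = u ∘ Fin.castLE htm then P (E ∩ cell u) else 0 := by
    intro s u
    split_ifs with h
    · congr 1
      ext ω
      constructor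
      · exact fun h' => ⟨h'.1.1, h'.2⟩
      · rintro ⟨h1, h2⟩
        refine ⟨⟨h1, ?_⟩, h2⟩
        have h3 : proj m ω = u := h2
        change proj t ω = s
        rw [h, ← h3]
        rfl
    · have : (E ∩ cell s) ∩ cell u = ∅ := by
        refine eq_empty_of_forall_notMem fun ω hω => h ?_
        have h1 : proj t ω = s := hω.1.2
        have h2 : proj m ω = u := hω.2
        rw [← h1, ← h2]
        rfl
      rw [this, P.apply_empty]
  have h1 : ∀ s : Fin t → Bool, g s * P (E ∩ cell s) =
      ∑ u : Fin m → Bool, if s = u ∘ Fin.castLE htm then g s * P (E ∩ cell u) else 0 := by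
    intro s
    rw [← P.sum_inter_cell h𝓢 m (hE.inter (measurableSet_cell h𝓢 s)), Finset.mul_sum]
    refine Finset.sum_congr rfl fun u _ => ?_
    rw [key, mul_ite, mul_zero]
  simp_rw [h1]
  rw [Finset.sum_comm]
  simp

end Cells

/-! ### The density martingale and its energy -/

/-- The density on the cell `s` of `P` with respect to `P + Q`. -/
noncomputable def ratio (P Q : FinAddProb 𝓢) {t : ℕ} (s : Fin t → Bool) : ℝ :=
  P (cell s) / (P (cell s) + Q (cell s))

/-- The squared norm of the density of `P` with respect to `P + Q` at time `t`. -/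
noncomputable def energy (P Q : FinAddProb 𝓢) (t : ℕ) : ℝ :=
  ∑ s : Fin t → Bool, P (cell s) ^ 2 / (P (cell s) + Q (cell s))

/-- The excess of `P` on `E` over its approximation by the density at time `t`. -/
noncomputable def excess (P Q : FinAddProb 𝓢) (t : ℕ) (E : Set Path) : ℝ :=
  ∑ s : Fin t → Bool, (P (E ∩ cell s) - ratio P Q s * (P (E ∩ cell s) + Q (E ∩ cell s)))

theorem ratio_nonneg (P Q : FinAddProb 𝓢) {t : ℕ} (s : Fin t → Bool) : 0 ≤ ratio P Q s :=
  div_nonneg (P.nonneg' _) (add_nonneg (P.nonneg' _) (Q.nonneg' _))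

theorem ratio_le_one (P Q : FinAddProb 𝓢) {t : ℕ} (s : Fin t → Bool) : ratio P Q s ≤ 1 :=
  div_le_one_of_le₀ (le_add_of_nonneg_right (Q.nonneg' _))
    (add_nonneg (P.nonneg' _) (Q.nonneg' _))

theorem sq_div_sub_eq {a b : ℝ} (ha : 0 ≤ a) (hb : 0 ≤ b) (h : ℝ) :
    a ^ 2 / (a + b) - 2 * h * a + h ^ 2 * (a + b) = (a - h * (a + b)) ^ 2 / (a + b) := by
  rcases (add_nonneg ha hb).eq_or_lt' with h0 | h0
  · have : a = 0 := by linarith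
    rw [h0, this]; simp
  · field_simp
    ring

theorem sub_le_add_sq_div {a b c : ℝ} (ha : 0 ≤ a) (hb : 0 ≤ b) (hc : 0 < c) (h : ℝ) :
    a - h * (a + b) ≤ c * (a + b) + (a - h * (a + b)) ^ 2 / (a + b) / c := by
  rcases (add_nonneg ha hb).eq_or_lt' with h0 | h0
  · have : a = 0 := by linarith
    rw [h0, this]; simp
  · set d := a - h * (a + b)
    rw [div_div, ← sub_le_iff_le_add', le_div_iff₀ (by positivity)]
    nlinarith [sq_nonneg (d - c * (a + b)), sq_nonneg d, sq_nonneg (c * (a + b))]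

theorem FinAddProb.le_add_diff (P : FinAddProb 𝓢) {E A S : Set Path} (hE : MeasurableSet[𝓢] E)
    (hA : MeasurableSet[𝓢] A) (hS : MeasurableSet[𝓢] S) :
    P (E ∩ S) ≤ P (A ∩ S) + P ((E \ A) ∩ S) := by
  rw [← P.inter_add_diff (hE.inter hS) hA]
  have h1 : P (E ∩ S ∩ A) ≤ P (A ∩ S) :=
    P.mono ((hE.inter hS).inter hA) (hA.inter hS) fun ω h => ⟨h.2, h.1.2⟩
  have h2 : (E ∩ S) \ A = (E \ A) ∩ S := by ext; simp; tauto
  rw [h2]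
  linarith

section Energy

variable (h𝓢 : ∀ (ω : Path) (t : ℕ), MeasurableSet[𝓢] (cylinder ω t))
include h𝓢

theorem energy_le_one (P Q : FinAddProb 𝓢) (t : ℕ) : energy P Q t ≤ 1 := by
  rw [← P.sum_cell h𝓢 t]
  refine Finset.sum_le_sum fun s _ => ?_
  refine div_le_of_le_mul₀ (add_nonneg (P.nonneg' _) (Q.nonneg' _)) (P.nonneg' _) ?_
  nlinarith [mul_nonneg (P.nonneg' (cell s)) (Q.nonneg' (cell s))]

/-- Pythagoras for a martingale: the energy gained is the squared norm of the density increment, as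
the cross terms collapse on the coarser cells. -/
theorem energy_sub (P Q : FinAddProb 𝓢) {t m : ℕ} (htm : t ≤ m) :
    energy P Q m - energy P Q t = ∑ u : Fin m → Bool,
      (P (cell u) - ratio P Q (u ∘ Fin.castLE htm) * (P (cell u) + Q (cell u))) ^ 2 /
        (P (cell u) + Q (cell u)) := by
  have hP := P.sum_restrict_mul h𝓢 htm (fun s => 2 * ratio P Q s) MeasurableSet.univ
  have hP2 := P.sum_restrict_mul h𝓢 htm (fun s => ratio P Q s ^ 2) MeasurableSet.univ
  have hQ2 := Q.sum_restrict_mul h𝓢 htm (fun s => ratio P Q s ^ 2) MeasurableSet.univ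
  simp only [univ_inter] at hP hP2 hQ2
  simp_rw [← sq_div_sub_eq (P.nonneg' _) (Q.nonneg' _), mul_add]
  rw [Finset.sum_add_distrib, Finset.sum_sub_distrib, Finset.sum_add_distrib, hP, hP2, hQ2,
    ← Finset.sum_add_distrib]
  have h1 : ∑ s : Fin t → Bool, 2 * ratio P Q s * P (cell s) = 2 * energy P Q t := by
    rw [energy, Finset.mul_sum]
    refine Finset.sum_congr rfl fun s _ => ?_
    rw [ratio]; ring
  have h2 : ∑ s : Fin t → Bool, (ratio P Q s ^ 2 * P (cell s) + ratio P Q s ^ 2 * Q (cell s)) =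
      energy P Q t := by
    refine Finset.sum_congr rfl fun s _ => ?_
    rw [← mul_add, ratio, div_pow]
    rcases eq_or_ne (P (cell s) + Q (cell s)) 0 with h0 | h0
    · rw [h0]; simp
    · field_simp
  rw [h1, h2, energy]
  ring

theorem energy_mono (P Q : FinAddProb 𝓢) : Monotone (energy P Q) := fun t m htm => by
  rw [← sub_nonneg, energy_sub h𝓢 P Q htm]
  exact Finset.sum_nonneg fun u _ =>
    div_nonneg (sq_nonneg _) (add_nonneg (P.nonneg' _) (Q.nonneg' _))

/-- On each fine cell, d ≤ cR + d²/(cR) with R the mass of P + Q and d the deviation of P. The 2 is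
the total mass of P + Q. -/
theorem excess_le_of_proj_preimage (P Q : FinAddProb 𝓢) {t m : ℕ} (htm : t ≤ m)
    (B : Set (Fin m → Bool)) {c : ℝ} (hc : 0 < c) :
    excess P Q t (proj m ⁻¹' B) ≤ 2 * c + (energy P Q m - energy P Q t) / c := by
  have hA := measurableSet_proj_preimage h𝓢 B
  set A := proj m ⁻¹' B
  have e1 : excess P Q t A = ∑ u : Fin m → Bool, (P (A ∩ cell u) -
      ratio P Q (u ∘ Fin.castLE htm) * (P (A ∩ cell u) + Q (A ∩ cell u))) := by
    have hP2 := P.sum_restrict_mul h𝓢 htm (fun s => ratio P Q s) hA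
    have hQ2 := Q.sum_restrict_mul h𝓢 htm (fun s => ratio P Q s) hA
    simp only [excess, mul_add, Finset.sum_add_distrib, Finset.sum_sub_distrib, hP2, hQ2,
      P.sum_inter_cell h𝓢 _ hA]
  have e2 : 2 * c + (energy P Q m - energy P Q t) / c = ∑ u : Fin m → Bool,
      (c * (P (cell u) + Q (cell u)) +
      (P (cell u) - ratio P Q (u ∘ Fin.castLE htm) * (P (cell u) + Q (cell u))) ^ 2 /
        (P (cell u) + Q (cell u)) / c) := by
    rw [energy_sub h𝓢 P Q htm, Finset.sum_add_distrib, ← Finset.mul_sum,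
      Finset.sum_add_distrib, P.sum_cell h𝓢, Q.sum_cell h𝓢, Finset.sum_div]
    ring
  rw [e1, e2]
  refine Finset.sum_le_sum fun u _ => ?_
  have hR : 0 ≤ P (cell u) + Q (cell u) := add_nonneg (P.nonneg' _) (Q.nonneg' _)
  by_cases hu : u ∈ B
  · have : A ∩ cell u = cell u := inter_eq_right.2 (preimage_mono (singleton_subset_iff.2 hu))
    rw [this]
    exact sub_le_add_sq_div (P.nonneg' _) (Q.nonneg' _) hc _
  · have : A ∩ cell u = ∅ := by
      rw [cell, ← preimage_inter, inter_singleton_eq_empty.2 hu, preimage_empty]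
    rw [this, P.apply_empty, Q.apply_empty]
    have := div_nonneg (div_nonneg (sq_nonneg (P (cell u) -
      ratio P Q (u ∘ Fin.castLE htm) * (P (cell u) + Q (cell u)))) hR) hc.le
    have := mul_nonneg hc.le hR
    linarith

theorem excess_le_of_mem_finDet (P Q : FinAddProb 𝓢) (t : ℕ) {A : Set Path} (hA : A ∈ finDet)
    {c : ℝ} (hc : 0 < c) :
    excess P Q t A ≤ 2 * c + ((⨆ m, energy P Q m) - energy P Q t) / c := by
  obtain ⟨n, hn⟩ := hA
  have hn' : ∀ ω, ∀ ω' ∈ cylinder ω (max t n), ω ∈ A → ω' ∈ A := fun ω ω' h =>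
    hn ω ω' (cylinder_anti ω (le_max_right t n) h)
  rw [eq_proj_preimage hn']
  refine (excess_le_of_proj_preimage h𝓢 P Q (le_max_left t n) _ hc).trans ?_
  gcongr
  exact le_ciSup (f := energy P Q) ⟨1, by rintro _ ⟨m, rfl⟩; exact energy_le_one h𝓢 P Q m⟩ _

theorem excess_le_add (P Q : FinAddProb 𝓢) (t : ℕ) {E A : Set Path} (hE : MeasurableSet[𝓢] E)
    (hA : MeasurableSet[𝓢] A) :
    excess P Q t E ≤ excess P Q t A + P (E \ A) + (P (A \ E) + Q (A \ E)) := by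
  rw [← P.sum_inter_cell h𝓢 t (hE.diff hA), ← P.sum_inter_cell h𝓢 t (hA.diff hE),
    ← Q.sum_inter_cell h𝓢 t (hA.diff hE), excess, excess, ← Finset.sum_add_distrib,
    ← Finset.sum_add_distrib, ← Finset.sum_add_distrib]
  refine Finset.sum_le_sum fun s _ => ?_
  have hs := measurableSet_cell h𝓢 s
  have h1 := P.le_add_diff hE hA hs
  have h2 := P.le_add_diff hA hE hs
  have h3 := Q.le_add_diff hA hE hs
  have h4 := mul_le_mul_of_nonneg_left (add_le_add h2 h3) (ratio_nonneg P Q s)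
  have h5 := mul_le_of_le_one_left
    (add_nonneg (P.nonneg' ((A \ E) ∩ cell s)) (Q.nonneg' ((A \ E) ∩ cell s))) (ratio_le_one P Q s)
  linarith

/-- The densities at time `t` approximate `P` uniformly over all events. -/
theorem eventually_excess_le {P Q : FinAddProb 𝓢} (hP : FinDetDense P) (hQ : AbsCont Q P) {η : ℝ}
    (hη : 0 < η) : ∀ᶠ t in atTop, ∀ E, MeasurableSet[𝓢] E → excess P Q t E ≤ η := by
  have hlim : Tendsto (energy P Q) atTop (𝓝 (⨆ m, energy P Q m)) :=
    tendsto_atTop_ciSup (energy_mono h𝓢 P Q) ⟨1, by rintro _ ⟨m, rfl⟩; exact energy_le_one h𝓢 P Q m⟩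
  -- With c = η/4, an energy gap below η²/32 contributes at most η/8; adding 2c = η/2 and three
  -- errors of η/16 stays below η.
  have hev := hlim.eventually_const_lt (u := (⨆ m, energy P Q m) - η ^ 2 / 32)
    (by linarith [pow_pos hη 2])
  filter_upwards [hev] with t ht E hE
  -- Density controls A \ E only under `P`; absolute continuity carries the bound over to `Q`.
  obtain ⟨δ, hδ, hδ'⟩ := hQ.exists_pos (show 0 < η / 16 by positivity)
  obtain ⟨A, hA, h1, h2⟩ := hP E hE (min δ (η / 16)) (by positivity)
  have hAm := measurableSet_of_mem_finDet h𝓢 hA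
  have h3 := hδ' _ (hAm.diff hE) (h2.trans_le (min_le_left _ _))
  have h4 := h1.trans_le (min_le_right _ _)
  have h5 := h2.trans_le (min_le_right _ _)
  have h6 := excess_le_of_mem_finDet h𝓢 P Q t hA (show 0 < η / 4 by positivity)
  have h7 : ((⨆ m, energy P Q m) - energy P Q t) / (η / 4) ≤ η / 8 := by
    rw [div_le_iff₀ (by positivity)]
    nlinarith
  linarith [excess_le_add h𝓢 P Q t hE hAm]

end Energy

/-! ### From uniform density approximation to merging -/

/-- The distance between the forecasts of `P` and `Q` on the cell `s`. -/
noncomputable def cellDist (P Q : FinAddProb 𝓢) {t : ℕ} (s : Fin t → Bool) : ℝ :=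
  ⨆ E : {E : Set Path // MeasurableSet[𝓢] E}, |condProb P E.1 (cell s) - condProb Q E.1 (cell s)|

theorem forecastDist_eq_cellDist (P Q : FinAddProb 𝓢) (ω : Path) (t : ℕ) :
    forecastDist P Q ω t = cellDist P Q (proj t ω) := by
  rw [forecastDist, cellDist, cell, proj_preimage_singleton]

theorem condProb_compl (P : FinAddProb 𝓢) {E C : Set Path} (hE : MeasurableSet[𝓢] E)
    (hC : MeasurableSet[𝓢] C) (h : 0 < P C) : condProb P Eᶜ C = 1 - condProb P E C := by
  have h1 := P.inter_add_diff hC hE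
  rw [condProb, condProb, inter_comm Eᶜ, inter_comm E, ← sdiff_eq, eq_sub_iff_add_eq, ← add_div,
    add_comm, h1, div_self h.ne']

/-- With a, b the masses of the cell under P, Q, its excess is ab/(a+b) times the difference of
conditional probabilities, and ab/(a+b) ≥ κb/2 when a ≥ κb and κ ≤ 1. -/
theorem le_sub_ratio_mul (P Q : FinAddProb 𝓢) {t : ℕ} {s : Fin t → Bool} {ε κ : ℝ} (hε : 0 < ε)
    (hκ₀ : 0 < κ) (hκ₁ : κ ≤ 1) (hQ : 0 < Q (cell s)) (hPQ : κ * Q (cell s) ≤ P (cell s))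
    {E : Set Path} (hE : ε < condProb P E (cell s) - condProb Q E (cell s)) :
    ε * κ / 2 * Q (cell s) ≤
      P (E ∩ cell s) - ratio P Q s * (P (E ∩ cell s) + Q (E ∩ cell s)) := by
  have hP : 0 < P (cell s) := (mul_pos hκ₀ hQ).trans_le hPQ
  unfold condProb at hE
  unfold ratio
  set a := P (cell s)
  set b := Q (cell s)
  set x := P (E ∩ cell s)
  set y := Q (E ∩ cell s)
  have e1 : x - a / (a + b) * (x + y) = a * b / (a + b) * (x / a - y / b) := by
    field_simp
    ring
  have e2 : κ / 2 * b ≤ a * b / (a + b) := by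
    rw [le_div_iff₀ (by positivity)]
    have : κ * a ≤ a := mul_le_of_le_one_left hP.le hκ₁
    nlinarith
  rw [e1]
  calc ε * κ / 2 * b = κ / 2 * b * ε := by ring
    _ ≤ a * b / (a + b) * (x / a - y / b) := by gcongr

section Merging

variable (h𝓢 : ∀ (ω : Path) (t : ℕ), MeasurableSet[𝓢] (cylinder ω t))
include h𝓢

/-- Passing to the complement of an event flips the sign of the difference, so the absolute value
can be dropped. -/
theorem exists_lt_condProb_sub (P Q : FinAddProb 𝓢) {t : ℕ} {s : Fin t → Bool} {ε : ℝ}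
    (h : ε < cellDist P Q s) (hP : 0 < P (cell s)) (hQ : 0 < Q (cell s)) :
    ∃ E, MeasurableSet[𝓢] E ∧ ε < condProb P E (cell s) - condProb Q E (cell s) := by
  have : Nonempty {E : Set Path // MeasurableSet[𝓢] E} := ⟨⟨∅, MeasurableSet.empty⟩⟩
  obtain ⟨⟨E, hE⟩, h1⟩ := exists_lt_of_lt_ciSup h
  have hs := measurableSet_cell h𝓢 s
  rcases lt_abs.1 h1 with h2 | h2
  · exact ⟨E, hE, h2⟩
  · refine ⟨Eᶜ, hE.compl, ?_⟩
    rw [condProb_compl P hE hs hP, condProb_compl Q hE hs hQ]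
    simp only at h2
    linarith

theorem apply_forecastDist_le (P Q : FinAddProb 𝓢) (t : ℕ) {ε κ η : ℝ} (hε : 0 < ε) (hκ₀ : 0 < κ)
    (hκ₁ : κ ≤ 1) (hη : ∀ E, MeasurableSet[𝓢] E → excess P Q t E ≤ η) :
    ε * κ / 2 * Q {ω | ε < forecastDist P Q ω t} ≤
      η + ε * κ / 2 * Q (proj t ⁻¹' {s | P (cell s) < κ * Q (cell s)}) := by
  classical
  have hB : {ω | ε < forecastDist P Q ω t} = proj t ⁻¹' {s | ε < cellDist P Q s} := by
    ext ω; simp [forecastDist_eq_cellDist]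
  have hF : ∀ s : Fin t → Bool, ∃ F, MeasurableSet[𝓢] F ∧
      ε * κ / 2 * (if s ∈ {s | ε < cellDist P Q s} then Q (cell s) else 0) ≤
        P (F ∩ cell s) - ratio P Q s * (P (F ∩ cell s) + Q (F ∩ cell s)) +
        ε * κ / 2 * (if s ∈ {s | P (cell s) < κ * Q (cell s)} then Q (cell s) else 0) := by
    intro s
    have hpos : 0 ≤ ε * κ / 2 * Q (cell s) := mul_nonneg (by positivity) (Q.nonneg' _)
    by_cases h1 : ε < cellDist P Q s ∧ 0 < Q (cell s) ∧ κ * Q (cell s) ≤ P (cell s)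
    · obtain ⟨h1, h2, h3⟩ := h1
      obtain ⟨E, hE, hE'⟩ :=
        exists_lt_condProb_sub h𝓢 P Q h1 ((mul_pos hκ₀ h2).trans_le h3) h2
      refine ⟨E, hE, ?_⟩
      rw [if_pos (by exact h1), if_neg (by exact not_lt.2 h3), mul_zero, add_zero]
      exact le_sub_ratio_mul P Q hε hκ₀ hκ₁ h2 h3 hE'
    · refine ⟨∅, MeasurableSet.empty, ?_⟩
      rw [empty_inter, P.apply_empty, Q.apply_empty, add_zero, mul_zero, sub_zero, zero_add]
      refine mul_le_mul_of_nonneg_left ?_ (by positivity)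
      by_cases h2 : ε < cellDist P Q s
      · rcases (Q.nonneg' (cell s)).eq_or_lt' with h3 | h3
        · simp [h3]
        · rw [if_pos (by exact h2), if_pos]
          exact lt_of_not_ge fun h4 => h1 ⟨h2, h3, h4⟩
      · rw [if_neg (by exact h2)]
        split_ifs
        · exact Q.nonneg' _
        · exact le_rfl
  -- The witnesses of all cells are glued into a single event, to which the uniform bound on the
  -- excess applies.
  choose F hFm hF using hF
  set E : Set Path := ⋃ s, F s ∩ cell s with hE
  have hEm : MeasurableSet[𝓢] E :=
    MeasurableSet.iUnion fun s => (hFm s).inter (measurableSet_cell h𝓢 s)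
  have hEs : ∀ s, E ∩ cell s = F s ∩ cell s := by
    intro s
    ext ω
    constructor
    · rintro ⟨h1, h2⟩
      obtain ⟨s', h3, h4⟩ := mem_iUnion.1 h1
      have h5 : proj t ω = s := h2
      have h6 : proj t ω = s' := h4
      rw [h5] at h6
      subst h6
      exact ⟨h3, h2⟩
    · exact fun h => ⟨mem_iUnion.2 ⟨s, h⟩, h.2⟩
  have hsum := Finset.sum_le_sum fun s (_ : s ∈ Finset.univ) => hF s
  rw [Finset.sum_add_distrib, ← Finset.mul_sum, ← Finset.mul_sum, ← Q.apply_proj_preimage h𝓢,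
    ← Q.apply_proj_preimage h𝓢, ← hB] at hsum
  have hex : excess P Q t E = ∑ s : Fin t → Bool,
      (P (F s ∩ cell s) - ratio P Q s * (P (F s ∩ cell s) + Q (F s ∩ cell s))) := by
    simp only [excess, hEs]
  linarith [hη E hEm]

/-- If every event is approximable by finitely determined ones, then the Blackwell--Dubins
property holds. -/
theorem blackwellDubins_of_finDetDense {P : FinAddProb 𝓢} (hP : FinDetDense P) :
    BlackwellDubins P := by
  classical
  intro Q hQ ε hε
  rw [Metric.tendsto_atTop']
  intro τ hτ
  obtain ⟨δ, hδ, hδ'⟩ := hQ.exists_pos (show 0 < τ / 2 by positivity)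
  -- Cells with P < κQ have total P-mass at most κ < δ, hence Q-mass below τ/2.
  set κ := min (δ / 2) 1 with hκ
  have hκ₀ : 0 < κ := by positivity
  obtain ⟨N, hN⟩ := eventually_atTop.1
    (eventually_excess_le h𝓢 hP hQ (show 0 < ε * κ / 2 * (τ / 4) by positivity))
  refine ⟨N, fun t ht => ?_⟩
  have h1 := apply_forecastDist_le h𝓢 P Q t hε hκ₀ (min_le_right _ _) (hN t ht.le)
  have h2 : P (proj t ⁻¹' {s | P (cell s) < κ * Q (cell s)}) ≤ κ := by
    rw [P.apply_proj_preimage h𝓢]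
    calc _ ≤ ∑ s : Fin t → Bool, κ * Q (cell s) := by
          refine Finset.sum_le_sum fun s _ => ?_
          split_ifs with h
          · exact h.le
          · exact mul_nonneg hκ₀.le (Q.nonneg' _)
      _ = κ := by rw [← Finset.mul_sum, Q.sum_cell h𝓢, mul_one]
  have h3 := hδ' _ (measurableSet_proj_preimage h𝓢 {s | P (cell s) < κ * Q (cell s)})
    (by linarith [min_le_left (δ / 2) 1])
  rw [← mul_add] at h1
  have h4 := le_of_mul_le_mul_left h1 (by positivity)
  rw [Real.dist_eq, sub_zero, abs_of_nonneg (Q.nonneg' _)]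
  linarith

end Merging

/-! ### An opinion that vanishes on small sets, and the theorem -/

theorem IsStrictlyProperIdeal.insert_empty {I : Set (Set Path)} (hI : IsStrictlyProperIdeal I) :
    IsStrictlyProperIdeal (insert ∅ I) where
  mem_of_subset S R hS h := by
    rcases hS with rfl | hS
    · exact Or.inl (subset_empty_iff.1 h)
    · exact Or.inr (hI.mem_of_subset S R hS h)
  union_mem R S hR hS := by
    rcases hR with rfl | hR
    · rwa [empty_union]
    · rcases hS with rfl | hS
      · rw [union_empty]; exact Or.inr hR
      · exact Or.inr (hI.union_mem R S hR hS)
  cylinder_notMem ω t h := by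
    rcases h with h | h
    · exact (Set.nonempty_of_mem (self_mem_cylinder ω t)).ne_empty h
    · exact hI.cylinder_notMem ω t h

/-- There is an opinion with the Blackwell--Dubins property which gives probability zero to all
small sets. -/
theorem exists_mem_opinionsBD_forall_eq_zero
    (h𝓢 : ∀ (ω : Path) (t : ℕ), MeasurableSet[𝓢] (cylinder ω t)) {I : Set (Set Path)}
    (hI : IsStrictlyProperIdeal I) : ∃ P ∈ opinionsBD 𝓢, ∀ S ∈ I, P.1 S = 0 := by
  -- The collection `I` may itself be empty, so ∅ is adjoined first.
  obtain ⟨q, hq, hadd, h0, G, hG, hG'⟩ :=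
    exists_additive_capacity hI.insert_empty (mem_insert ∅ I)
  have hS : IsSavagean (hq.toFinAddProb hadd 𝓢) := by
    refine isSavagean_of_continuous h𝓢 hG fun x y hxy => ?_
    rw [hq.toFinAddProb_apply hadd
      (measurableSet_of_isClosed h𝓢 (isClosed_Icc.preimage continuous_cantorCoord))]
    exact hG' x y hxy
  refine ⟨⟨_, hS⟩, blackwellDubins_of_finDetDense h𝓢 (hq.finDetDense_toFinAddProb h𝓢 hadd),
    fun S hSI => ?_⟩
  by_cases hSm : MeasurableSet[𝓢] S
  · exact (hq.toFinAddProb_apply hadd hSm).trans (h0 S (mem_insert_of_mem _ hSI))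
  · exact FinAddProb.zero_of_not_event _ S hSm

/-- The strategy that always announces the opinion `P`. -/
noncomputable def Strategy.pure (P : Opinion 𝓢) : Strategy 𝓢 :=
  ⟨PMF.pure P, by rw [PMF.support_pure]; exact finite_singleton P⟩

theorem Strategy.prob_pure_eq_one_iff (P : Opinion 𝓢) (A : Set (Opinion 𝓢)) :
    (Strategy.pure P).prob A = 1 ↔ P ∈ A := by
  rw [Strategy.prob, Strategy.pure, PMF.toOuterMeasure_apply_eq_one_iff, PMF.support_pure,
    singleton_subset_iff]

end OpinionTest

theorem corollary1 (𝓢 : MeasurableSpace OpinionTest.Path)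
    (h𝓢 : ∀ (ω : OpinionTest.Path) (t : ℕ), MeasurableSet[𝓢] (PiNat.cylinder ω t))
    (I : Set (Set OpinionTest.Path)) (hI : OpinionTest.IsStrictlyProperIdeal I)
    (T : OpinionTest.Test 𝓢) (ε : ℝ) (hε₀ : 0 ≤ ε) (hε₁ : ε < 1)
    (hT : OpinionTest.ControlsTypeIError T (OpinionTest.opinionsBD 𝓢) ε) :
    ∃ ζ : OpinionTest.Strategy 𝓢,
      {ω : OpinionTest.Path | ζ.prob {P : OpinionTest.Opinion 𝓢 | ω ∉ T P} = 1} ∉ I := by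
  obtain ⟨P, hP, hP0⟩ := OpinionTest.exists_mem_opinionsBD_forall_eq_zero h𝓢 hI
  refine ⟨OpinionTest.Strategy.pure P, fun hmem => ?_⟩
  have hset : {ω : OpinionTest.Path | (OpinionTest.Strategy.pure P).prob
      {P : OpinionTest.Opinion 𝓢 | ω ∉ T P} = 1} = (T P : Set OpinionTest.Path)ᶜ := by
    ext ω
    exact OpinionTest.Strategy.prob_pure_eq_one_iff P _
  rw [hset] at hmem
  -- The acceptance set is closed, hence an event, so its value 0 under `P` is a genuine probability
  -- and not the default for non-events.
  have hcl := OpinionTest.measurableSet_of_isClosed h𝓢 (T P).isOpen.isClosed_compl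
  have h1 := P.1.apply_compl hcl.of_compl
  have h2 := hP0 _ hmem
  have h3 := hT P hP
  linarith
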